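/- Let $a,b,a_c,b_c>0$ and $c$ be real numbers with $$-c^2a_c^2+(ab+ab_c+a_cb)(ab-ab_c-a_cb)=0,$$ and consider the pair of ellipses centered at the origin $O$ $$\mathcal{E}:\ (b^2+c^2)x^2-2acxy+a^2y^2-a^2b^2=0,\qquad \mathcal{E}_c:\ \frac{x^2}{a_c^2}+\frac{y^2}{b_c^2}-1=0$$ (the pair is tilted when $c\neq0$). A 3-periodic of the pair is a triangle whose vertices lie on $\mathcal{E}$ and whose sides lie on lines tangent to $\mathcal{E}_c$. Let $\mathcal{E}_3$ and $\mathcal{E}_5$ be the sets of all circumcenters $X_3$, respectively of all nine-point centers $X_5$, of the 3-periodics. **(i)** If $\mathcal{E}$ is not a circle (that is, unless $a=b$ and $c=0$; in particular whenever $c\ne0$), then $\mathcal{E}_3$ is an ellipse centered at $O$ whose axes lie along the coordinate axes, hence along those of $\mathcal{E}_c$, and the ratio of its semi-axis in the $x$-direction to its semi-axis in the $y$-direction is $b_c/a_c$. **(ii)** $\mathcal{E}_3$ is the set of all $(x,y)$ with $$4b^2a_c^2\left(a_c^2x^2+b_c^2y^2\right)-b_c^2\Big((a_c^2-b_c^2+b^2)a+2a_cb(a_c-b_c)\Big)\Big((a_c^2-b_c^2+b^2)a-2a_cb(a_c+b_c)\Big)=0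 .$$ **(iii)** $\mathcal{E}_5$ is an ellipse centered at $O$ with semi-axes $|a_5|$ and $|b_5|$, where $$a_5=\frac{aa_c^2b_c+ab^2b_c-ab_c^3-2a_c^3b-2a_cbb_c^2}{4a_c^2b},\qquad b_5=\frac{aa_c^2-4a_cbb_c+a(b^2-b_c^2)}{4a_cb},$$ provided that $a_5\ne0$ and $b_5\neq0$. In all cases there are orthogonal unit vectors $u,v$ with $\mathcal{E}_5=\{|a_5|\cos t\,u+|b_5|\sin t\,v : t\in\mathbb{R}\}$, which is a segment or a point when $a_5$ or $b_5$ vanishes. -/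

import Mathlib

/-- The Euclidean plane. -/
abbrev Plane : Type := EuclideanSpace ℝ (Fin 2)

/-- The image of a vector under the rotation by a right angle. -/
noncomputable def rot90 (u : Plane) : Plane := !₂[-(u 1), u 0]

/-- `S` is the (nondegenerate) ellipse with center `O` and semi-axes of lengths `p, q > 0`,
the first one in the direction of the unit vector `u`, the second one orthogonal to it.
No order between `p` and `q` is imposed. -/
def IsEllipse (S : Set Plane) (O u : Plane) (p q : ℝ) : Prop :=
  ‖u‖ = 1 ∧ 0 < p ∧ 0 < q ∧
    S = {X : Plane | (inner ℝ u (X - O) / p) ^ 2 + (inner ℝ (rot90 u) (X - O) / q) ^ 2 = 1}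

/-- The outer ellipse `(b² + c²) x² - 2 a c x y + a² y² = a² b²`. It is centered at the origin;
the pair is axis-aligned exactly when `c = 0`. Here `c` is a free shear parameter. -/
def outerEllipse (a b c : ℝ) : Set Plane :=
  {X : Plane | (b ^ 2 + c ^ 2) * X 0 ^ 2 - 2 * a * c * X 0 * X 1 + a ^ 2 * X 1 ^ 2
    - b ^ 2 * a ^ 2 = 0}

/-- The inner ellipse `x² / a_c² + y² / b_c² = 1`. -/
def innerEllipse (ac bc : ℝ) : Set Plane :=
  {X : Plane | X 0 ^ 2 / ac ^ 2 + X 1 ^ 2 / bc ^ 2 - 1 = 0}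

/-- The line through `A` and `B` is tangent to the ellipse `S`: it meets `S` exactly once. -/
def LineTangent (S : Set Plane) (A B : Plane) : Prop :=
  ∃! X : Plane, X ∈ line[ℝ, A, B] ∧ X ∈ S

/-- A Poncelet 3-periodic: a triangle inscribed in `E` all of whose sides are tangent to `E'`. -/
def IsThreePeriodic (E E' : Set Plane) (T : Affine.Triangle ℝ Plane) : Prop :=
  (∀ i, T.points i ∈ E) ∧ ∀ i j, i ≠ j → LineTangent E' (T.points i) (T.points j)

/-- The locus of the circumcenter over the 3-periodics of the pair `E, E'`. -/
def locusX3 (E E' : Set Plane) : Set Plane :=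
  {X : Plane | ∃ T : Affine.Triangle ℝ Plane, IsThreePeriodic E E' T ∧ X = T.circumcenter}

/-- The locus of the center of the nine-point circle over the 3-periodics of the pair `E, E'`. -/
def locusX5 (E E' : Set Plane) : Set Plane :=
  {X : Plane | ∃ T : Affine.Triangle ℝ Plane, IsThreePeriodic E E' T ∧
    X = T.ninePointCircle.center}

/-- The first semi-axis (with a sign) of the locus of the nine-point center. -/
noncomputable def semiAxisA5 (a b ac bc : ℝ) : ℝ :=
  (a * ac ^ 2 * bc + a * b ^ 2 * bc - a * bc ^ 3 - 2 * ac ^ 3 * b - 2 * ac * b * bc ^ 2)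
    / (4 * ac ^ 2 * b)

/-- The second semi-axis (with a sign) of the locus of the nine-point center. -/
noncomputable def semiAxisB5 (a b ac bc : ℝ) : ℝ :=
  (a * ac ^ 2 - 4 * ac * b * bc + a * (b ^ 2 - bc ^ 2)) / (4 * b * ac)

/-! A linear map `shearMap` carries the unit circle of ℂ onto the outer ellipse, so vertices become
unit complex numbers. Let F = `ponceletConst`; it is f², where ±f are the foci of the pulled-back
inner ellipse. The Cayley condition gives |F| < 1 and turns tangency of the chord zw into (z+w)² =
(F+zw)(F̄zw+1) (`lineTangent_shearMap_iff`). Hence the 3-periodics are the images of unit triples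
with second symmetric function e₂ = -F (`isThreePeriodic_iff`). Conjugation then gives e₁ = -F̄e₃,
so the only free parameter is l = e₃. It runs over the whole unit circle, since the triples are the
fibres of a Blaschke product of degree 3 (`exists_unit_triple`).

Both centers are real-linear in l, so each locus is a linear image of a circle. For X₃, a linear
change of unknown H ↦ H + F̄H̄ isolates l̄, and |l| = 1 becomes the stated equation. For X₅, the
locus is {Ul + Vl̄}, with semi-axes | |U| ± |V| |; the Cayley condition evaluates |U| and |V|. -/

open scoped ComplexConjugate

/-! ### The outer ellipse as an image of the unit circle. -/

/-- The linear map taking the unit circle of `ℂ` onto the outer ellipse. -/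
noncomputable def shearMap (a b c : ℝ) : ℂ →ₗ[ℝ] Plane where
  toFun w := !₂[a * w.re, c * w.re + b * w.im]
  map_add' z w := by
    ext i; fin_cases i <;> simp <;> ring
  map_smul' r w := by
    ext i; fin_cases i <;> simp <;> ring

@[simp] theorem shearMap_zero_coord (a b c : ℝ) (w : ℂ) : shearMap a b c w 0 = a * w.re := rfl

@[simp] theorem shearMap_one_coord (a b c : ℝ) (w : ℂ) :
    shearMap a b c w 1 = c * w.re + b * w.im := rfl

theorem plane_ext {X Y : Plane} (h0 : X 0 = Y 0) (h1 : X 1 = Y 1) : X = Y := by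
  ext i; fin_cases i <;> assumption

theorem shearMap_injective {a b : ℝ} (c : ℝ) (ha : a ≠ 0) (hb : b ≠ 0) :
    Function.Injective (shearMap a b c) := by
  intro z w h
  have h0 : a * z.re = a * w.re := congrArg (fun X : Plane => X 0) h
  have h1 : c * z.re + b * z.im = c * w.re + b * w.im := congrArg (fun X : Plane => X 1) h
  have hre := mul_left_cancel₀ ha h0
  rw [hre] at h1
  exact Complex.ext hre (mul_left_cancel₀ hb (add_left_cancel h1))

theorem unit_re_im {w : ℂ} (hw : ‖w‖ = 1) : w.re ^ 2 + w.im ^ 2 = 1 := by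
  have h := Complex.normSq_apply w
  rw [Complex.normSq_eq_norm_sq, hw] at h
  linarith

theorem unit_mul_conj {w : ℂ} (hw : ‖w‖ = 1) : w * conj w = 1 := by
  rw [Complex.mul_conj, Complex.normSq_eq_norm_sq, hw]; simp

theorem mem_outerEllipse_iff {a b : ℝ} (c : ℝ) (ha : a ≠ 0) (hb : b ≠ 0) (X : Plane) :
    X ∈ outerEllipse a b c ↔ ∃ w : ℂ, ‖w‖ = 1 ∧ shearMap a b c w = X := by
  constructor
  · intro h
    change (b ^ 2 + c ^ 2) * X 0 ^ 2 - 2 * a * c * X 0 * X 1 + a ^ 2 * X 1 ^ 2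
      - b ^ 2 * a ^ 2 = 0 at h
    refine ⟨⟨X 0 / a, (X 1 - c * (X 0 / a)) / b⟩, ?_, ?_⟩
    · have : Complex.normSq ⟨X 0 / a, (X 1 - c * (X 0 / a)) / b⟩ = 1 := by
        rw [Complex.normSq_mk]
        field_simp
        linear_combination h
      rw [Complex.normSq_eq_norm_sq] at this
      nlinarith [norm_nonneg (⟨X 0 / a, (X 1 - c * (X 0 / a)) / b⟩ : ℂ)]
    · apply plane_ext
      · simp; field_simp
      · simp; field_simp; ring
  · rintro ⟨w, hw, rfl⟩
    have h := unit_re_im hw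
    change (b ^ 2 + c ^ 2) * (a * w.re) ^ 2 - 2 * a * c * (a * w.re) * (c * w.re + b * w.im)
      + a ^ 2 * (c * w.re + b * w.im) ^ 2 - b ^ 2 * a ^ 2 = 0
    linear_combination (a ^ 2 * b ^ 2) * h

/-! ### Tangency of chords to the inner ellipse. -/

theorem existsUnique_quadratic_root_iff {p q r : ℝ} (hp : p ≠ 0) :
    (∃! t : ℝ, p * t ^ 2 + 2 * q * t + r = 0) ↔ q ^ 2 - p * r = 0 := by
  constructor
  · rintro ⟨t, ht, huniq⟩
    -- By Vieta this is the other root, so uniqueness forces a double root.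
    have h2 := huniq (-2 * q / p - t) (by
      field_simp
      linear_combination p * ht)
    have h3 : p * t = -q := by
      field_simp at h2
      linear_combination h2 / (-2)
    linear_combination (-p) * ht + (q + p * t) * h3
  · intro h
    refine ⟨-q / p, ?_, ?_⟩
    · field_simp
      linear_combination -h
    · intro t ht
      have : (p * t + q) ^ 2 = 0 := by linear_combination p * ht + h
      have h0 := pow_eq_zero_iff (two_ne_zero) |>.1 this
      field_simp
      linear_combination h0

theorem lineTangent_innerEllipse_iff {ac bc : ℝ} (hac : ac ≠ 0) (hbc : bc ≠ 0) {A B : Plane}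
    (hAB : A ≠ B) :
    LineTangent (innerEllipse ac bc) A B ↔
      (A 0 * B 1 - A 1 * B 0) ^ 2 =
        bc ^ 2 * (B 0 - A 0) ^ 2 + ac ^ 2 * (B 1 - A 1) ^ 2 := by
  set D0 := B 0 - A 0 with hD0
  set D1 := B 1 - A 1 with hD1
  have hp : D0 ^ 2 / ac ^ 2 + D1 ^ 2 / bc ^ 2 ≠ 0 := by
    intro h
    have h0 : 0 ≤ D0 ^ 2 / ac ^ 2 := by positivity
    have h1 : 0 ≤ D1 ^ 2 / bc ^ 2 := by positivity
    have e0 : D0 ^ 2 / ac ^ 2 = 0 := by linarith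
    have e1 : D1 ^ 2 / bc ^ 2 = 0 := by linarith
    have e0' : D0 = 0 := by simpa [hac] using e0
    have e1' : D1 = 0 := by simpa [hbc] using e1
    exact hAB (plane_ext (by linarith) (by linarith))
  have hline : ∀ t : ℝ, AffineMap.lineMap A B t ∈ innerEllipse ac bc ↔
      (D0 ^ 2 / ac ^ 2 + D1 ^ 2 / bc ^ 2) * t ^ 2
        + 2 * (A 0 * D0 / ac ^ 2 + A 1 * D1 / bc ^ 2) * t
        + (A 0 ^ 2 / ac ^ 2 + A 1 ^ 2 / bc ^ 2 - 1) = 0 := by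
    intro t
    have : ∀ i, (AffineMap.lineMap A B t : Plane) i = A i + t * (B i - A i) := by
      intro i
      simp [AffineMap.lineMap_apply]
      ring
    change (AffineMap.lineMap A B t : Plane) 0 ^ 2 / ac ^ 2
      + (AffineMap.lineMap A B t : Plane) 1 ^ 2 / bc ^ 2 - 1 = 0 ↔ _
    rw [this, this, ← hD0, ← hD1]
    constructor <;> intro h <;> linear_combination h
  have hex : LineTangent (innerEllipse ac bc) A B ↔
      ∃! t : ℝ, AffineMap.lineMap A B t ∈ innerEllipse ac bc := by
    constructor
    · rintro ⟨X, ⟨hX, hX'⟩, hu⟩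
      obtain ⟨t, rfl⟩ := mem_affineSpan_pair_iff_exists_lineMap_eq.1 hX
      exact ⟨t, hX', fun s hs => AffineMap.lineMap_injective ℝ hAB
        (hu _ ⟨AffineMap.lineMap_mem_affineSpan_pair s A B, hs⟩)⟩
    · rintro ⟨t, ht, hu⟩
      refine ⟨AffineMap.lineMap A B t, ⟨AffineMap.lineMap_mem_affineSpan_pair t A B, ht⟩, ?_⟩
      rintro X ⟨hX, hX'⟩
      obtain ⟨s, rfl⟩ := mem_affineSpan_pair_iff_exists_lineMap_eq.1 hX
      rw [hu s hX']
  rw [hex, existsUnique_congr hline, existsUnique_quadratic_root_iff hp]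
  -- The reduced discriminant of the conic restricted to the line, with denominators cleared.
  have hkey : (A 0 * D0 / ac ^ 2 + A 1 * D1 / bc ^ 2) ^ 2 - (D0 ^ 2 / ac ^ 2 + D1 ^ 2 / bc ^ 2)
      * (A 0 ^ 2 / ac ^ 2 + A 1 ^ 2 / bc ^ 2 - 1)
      = (bc ^ 2 * D0 ^ 2 + ac ^ 2 * D1 ^ 2 - (A 0 * B 1 - A 1 * B 0) ^ 2)
        / (ac ^ 2 * bc ^ 2) := by
    have hB0 : B 0 = A 0 + D0 := by rw [hD0]; ring
    have hB1 : B 1 = A 1 + D1 := by rw [hD1]; ring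
    rw [hB0, hB1]
    clear_value D0 D1
    field_simp
    ring
  rw [hkey, div_eq_zero_iff, or_iff_left (by positivity), sub_eq_zero, eq_comm]

/-- The constant value of `-(w₀w₁ + w₁w₂ + w₂w₀)` over the 3-periodics. -/
noncomputable def ponceletConst (a b c ac bc : ℝ) : ℂ :=
  ⟨-((bc ^ 2 * a ^ 2 + ac ^ 2 * (c ^ 2 - b ^ 2)) / (a ^ 2 * b ^ 2)),
    -(2 * ac ^ 2 * c * b / (a ^ 2 * b ^ 2))⟩

theorem ponceletConst_im {a b : ℝ} (c ac bc : ℝ) (ha : a ≠ 0) (hb : b ≠ 0) :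
    (ponceletConst a b c ac bc).im = -(2 * ac ^ 2 * c / (a ^ 2 * b)) := by
  change -(2 * ac ^ 2 * c * b / (a ^ 2 * b ^ 2)) = _
  field_simp

theorem ponceletConst_re {a b c ac bc : ℝ} (ha : a ≠ 0) (hb : b ≠ 0)
    (h : -(c ^ 2 * ac ^ 2) + (a * b + a * bc + ac * b) * (a * b - a * bc - ac * b) = 0) :
    (ponceletConst a b c ac bc).re = -1 + 2 * ac ^ 2 / a ^ 2 + 2 * ac * bc / (a * b) := by
  change -((bc ^ 2 * a ^ 2 + ac ^ 2 * (c ^ 2 - b ^ 2)) / (a ^ 2 * b ^ 2)) = _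
  field_simp
  linear_combination h

/-- The Cayley condition eliminates c here; the value is visibly below 1, which gives |F| < 1. -/
theorem normSq_ponceletConst {a b c ac bc : ℝ} (ha : a ≠ 0) (hb : b ≠ 0)
    (h : -(c ^ 2 * ac ^ 2) + (a * b + a * bc + ac * b) * (a * b - a * bc - ac * b) = 0) :
    Complex.normSq (ponceletConst a b c ac bc) = 1 - 4 * ac * bc / (a * b) := by
  rw [Complex.normSq_apply, ponceletConst_re ha hb h, ponceletConst_im c ac bc ha hb]
  field_simp
  linear_combination (-4 * ac ^ 2) * h

theorem norm_ponceletConst_lt_one {a b c ac bc : ℝ} (ha : 0 < a) (hb : 0 < b) (hac : 0 < ac)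
    (hbc : 0 < bc)
    (h : -(c ^ 2 * ac ^ 2) + (a * b + a * bc + ac * b) * (a * b - a * bc - ac * b) = 0) :
    ‖ponceletConst a b c ac bc‖ < 1 := by
  have h1 := normSq_ponceletConst ha.ne' hb.ne' h
  rw [Complex.normSq_eq_norm_sq] at h1
  have h2 : 0 < 4 * ac * bc / (a * b) := by positivity
  nlinarith [norm_nonneg (ponceletConst a b c ac bc)]

/-- The chord of the outer ellipse joining the images of two points of the unit circle is tangent
to the inner ellipse if and only if the two points satisfy a symmetric biquadratic relation. -/
theorem lineTangent_shearMap_iff {a b c ac bc : ℝ} (ha : a ≠ 0) (hb : b ≠ 0) (hac : ac ≠ 0)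
    (hbc : bc ≠ 0)
    (h : -(c ^ 2 * ac ^ 2) + (a * b + a * bc + ac * b) * (a * b - a * bc - ac * b) = 0)
    {z w : ℂ} (hz : ‖z‖ = 1) (hw : ‖w‖ = 1) (hzw : z ≠ w) :
    LineTangent (innerEllipse ac bc) (shearMap a b c z) (shearMap a b c w) ↔
      (z + w) ^ 2 = (ponceletConst a b c ac bc + z * w)
        * (conj (ponceletConst a b c ac bc) * (z * w) + 1) := by
  rw [lineTangent_innerEllipse_iff hac hbc ((shearMap_injective c ha hb).ne hzw)]
  simp only [shearMap_zero_coord, shearMap_one_coord]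
  have ha' : (a : ℂ) ≠ 0 := by exact_mod_cast ha
  have hb' : (b : ℂ) ≠ 0 := by exact_mod_cast hb
  have hz1 := unit_mul_conj hz
  have hw1 := unit_mul_conj hw
  have hz0 : z ≠ 0 := left_ne_zero_of_mul_eq_one hz1
  have hw0 : w ≠ 0 := left_ne_zero_of_mul_eq_one hw1
  have hwz : w - z ≠ 0 := sub_ne_zero.2 hzw.symm
  set F := ponceletConst a b c ac bc with hF
  have hI := Complex.I_sq
  have hFe : (a : ℂ) ^ 2 * b ^ 2 * F
      = -(bc ^ 2 * a ^ 2 + ac ^ 2 * (c + Complex.I * b) ^ 2) := by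
    rw [← Complex.re_add_im F, hF, ponceletConst_im c ac bc ha hb]
    change (a : ℂ) ^ 2 * b ^ 2 * (((-((bc ^ 2 * a ^ 2 + ac ^ 2 * (c ^ 2 - b ^ 2))
      / (a ^ 2 * b ^ 2)) : ℝ) : ℂ) + _) = _
    push_cast
    field_simp
    linear_combination ((ac : ℂ) ^ 2 * b ^ 2) * hI
  have hFc : (a : ℂ) ^ 2 * b ^ 2 * conj F
      = -(bc ^ 2 * a ^ 2 + ac ^ 2 * (c - Complex.I * b) ^ 2) := by
    have := congrArg conj hFe
    simp only [map_mul, map_pow, map_neg, map_add, Complex.conj_ofReal, Complex.conj_I] at this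
    rw [this]; ring
  -- With p = zw, tangency reads (z+w)² = F̄p² + Np + F. The Cayley condition gives N = 1 + |F|², so
  -- the right side factors as (F+p)(F̄p+1).
  have hN : (a : ℂ) ^ 2 * b ^ 2 * (1 + F * conj F)
      = 2 * (bc ^ 2 * a ^ 2 + ac ^ 2 * (b ^ 2 + c ^ 2)) := by
    rw [Complex.mul_conj, normSq_ponceletConst ha hb h]
    have hC : -((c : ℂ) ^ 2 * ac ^ 2) + (a * b + a * bc + ac * b) * (a * b - a * bc - ac * b) = 0 := by
      exact_mod_cast h
    push_cast
    field_simp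
    linear_combination 2 * hC
  have hre : ∀ u : ℂ, (u.re : ℂ) = (u + conj u) / 2 := Complex.re_eq_add_conj
  have him : ∀ u : ℂ, Complex.I * (u.im : ℂ) = (u - conj u) / 2 := by
    intro u
    rw [Complex.im_eq_sub_conj]
    field_simp
  set X : ℝ := w.re - z.re with hX
  set Y : ℝ := w.im - z.im with hY
  set K : ℝ := z.re * w.im - z.im * w.re with hK
  -- Since z̄ = 1/z on the unit circle, multiplying X, iY and iK by 2zw gives polynomials divisible
  -- by w - z; the factor (w-z)² can then be cancelled from the tangency condition.
  have hXc : 2 * (z * w) * (X : ℂ) = (w - z) * (z * w - 1) := by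
    rw [hX]; push_cast; rw [hre, hre]
    linear_combination (-w) * hz1 + z * hw1
  have hYc : 2 * (z * w) * (Complex.I * (Y : ℂ)) = (w - z) * (z * w + 1) := by
    rw [hY]; push_cast; rw [mul_sub, him, him]
    linear_combination w * hz1 - z * hw1
  have hKc : 2 * (z * w) * (Complex.I * (K : ℂ)) = (w - z) * (w + z) := by
    rw [hK]; push_cast
    have : Complex.I * ((z.re : ℂ) * w.im - z.im * w.re)
      = z.re * (Complex.I * w.im) - (Complex.I * z.im) * w.re := by ring
    rw [this, hre, hre, him, him]
    linear_combination w ^ 2 * hz1 - z ^ 2 * hw1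
  have hE : 4 * (z * w) ^ 2 * (((a * b * K) ^ 2 - bc ^ 2 * (a * X) ^ 2
        - ac ^ 2 * (c * X + b * Y) ^ 2 : ℝ) : ℂ)
      = -((w - z) ^ 2 * (a ^ 2 * b ^ 2) * ((z + w) ^ 2 - (F + z * w) * (conj F * (z * w) + 1))) := by
    have e1 : 4 * (z * w) ^ 2 * (((a * b * K) ^ 2 - bc ^ 2 * (a * X) ^ 2
        - ac ^ 2 * (c * X + b * Y) ^ 2 : ℝ) : ℂ)
      = -(a ^ 2 * b ^ 2 * (2 * (z * w) * (Complex.I * (K : ℂ))) ^ 2)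
        - bc ^ 2 * a ^ 2 * (2 * (z * w) * (X : ℂ)) ^ 2
        - ac ^ 2 * (c * (2 * (z * w) * (X : ℂ))
          - Complex.I * b * (2 * (z * w) * (Complex.I * (Y : ℂ)))) ^ 2 := by
      push_cast
      linear_combination (4 * (z * w) ^ 2 * (a ^ 2 * b ^ 2 * K ^ 2
        + ac ^ 2 * (b ^ 2 * Y ^ 2 * (Complex.I ^ 2 - 1) - 2 * c * X * b * Y))) * hI
    rw [e1, hXc, hYc, hKc]
    linear_combination -(w - z) ^ 2 * (hFe + (z * w) ^ 2 * hFc + (z * w) * hN)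
      - (w - z) ^ 2 * ac ^ 2 * 2 * (z * w) * b ^ 2 * hI
  have hlhs : (a * z.re * (c * w.re + b * w.im) - (c * z.re + b * z.im) * (a * w.re)) ^ 2 =
        bc ^ 2 * (a * w.re - a * z.re) ^ 2
          + ac ^ 2 * (c * w.re + b * w.im - (c * z.re + b * z.im)) ^ 2 ↔
      (a * b * K) ^ 2 - bc ^ 2 * (a * X) ^ 2 - ac ^ 2 * (c * X + b * Y) ^ 2 = 0 := by
    rw [hX, hY, hK]
    constructor <;> intro h <;> linear_combination h
  rw [hlhs]
  constructor
  · intro h0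
    rw [h0, Complex.ofReal_zero, mul_zero, eq_comm, neg_eq_zero] at hE
    have h2 : (w - z) ^ 2 * ((a : ℂ) ^ 2 * b ^ 2) ≠ 0 := by
      exact mul_ne_zero (pow_ne_zero _ hwz) (mul_ne_zero (pow_ne_zero _ ha') (pow_ne_zero _ hb'))
    exact sub_eq_zero.1 ((mul_eq_zero.1 hE).resolve_left h2)
  · intro h0
    rw [h0, sub_self, mul_zero, neg_zero] at hE
    have h2 : 4 * (z * w) ^ 2 ≠ 0 :=
      mul_ne_zero (by norm_num) (pow_ne_zero _ (mul_ne_zero hz0 hw0))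
    exact_mod_cast (mul_eq_zero.1 hE).resolve_left h2

/-! ### 3-periodics as unit triples with e₂ = -F. -/

theorem one_sub_mul_conj_ne_zero {F : ℂ} (hF : ‖F‖ < 1) : 1 - F * conj F ≠ 0 := by
  rw [Complex.mul_conj, Complex.normSq_eq_norm_sq, sub_ne_zero]
  intro h
  have : 1 = ‖F‖ ^ 2 := by exact_mod_cast h
  nlinarith [norm_nonneg F]

theorem conj_mul_ne_one {F u : ℂ} (hF : ‖F‖ < 1) (hu : ‖u‖ = 1) : conj F * u ≠ 1 := by
  intro h
  have := congrArg norm h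
  rw [norm_mul, RCLike.norm_conj, hu, norm_one] at this
  linarith

/-- If two distinct points are related to `x` by the tangency relation, the triangle closes up
with a constant second symmetric function. -/
theorem symm_two_eq_of_tangency {F x y z : ℂ} (hF : ‖F‖ < 1) (hx : ‖x‖ = 1) (hyz : y ≠ z)
    (hy : (x + y) ^ 2 = (F + x * y) * (conj F * (x * y) + 1))
    (hz : (x + z) ^ 2 = (F + x * z) * (conj F * (x * z) + 1)) :
    x * y + y * z + z * x = -F := by
  have hk : conj F * x ^ 2 - 1 ≠ 0 :=
    sub_ne_zero.2 (conj_mul_ne_one hF (by rw [norm_pow, hx, one_pow]))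
  have hyz' : y - z ≠ 0 := sub_ne_zero.2 hyz
  -- The tangency relation at x is quadratic in the other endpoint, with roots y and z; `hs` and
  -- `hp` are Vieta's formulas, and `hk` says that the leading coefficient is nonzero.
  have hs : (conj F * x ^ 2 - 1) * (y + z) = x * (1 - F * conj F) := by
    apply mul_left_cancel₀ hyz'
    linear_combination hz - hy
  have hp : (conj F * x ^ 2 - 1) * (y * z) = F - x ^ 2 := by
    linear_combination hy + y * hs
  apply mul_left_cancel₀ hk
  linear_combination x * hs + hp

/-- Conjugation inverts unit numbers, so the conjugate of e₂ is e₁/e₃. -/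
theorem conj_symm_two {F x y z : ℂ} (hx : ‖x‖ = 1) (hy : ‖y‖ = 1) (hz : ‖z‖ = 1)
    (h : x * y + y * z + z * x = -F) : x + y + z = -(conj F * (x * y * z)) := by
  have h' := congrArg conj h
  simp only [map_add, map_mul, map_neg] at h'
  have h1 := unit_mul_conj hx
  have h2 := unit_mul_conj hy
  have h3 := unit_mul_conj hz
  have e1 : x * y * z * (conj x * conj y) = z := by linear_combination z * y * conj y * h1 + z * h2
  have e2 : x * y * z * (conj y * conj z) = x := by linear_combination x * z * conj z * h2 + x * h3
  have e3 : x * y * z * (conj z * conj x) = y := by linear_combination y * x * conj x * h3 + y * h1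
  linear_combination (x * y * z) * h' - e1 - e2 - e3

/-- Both factors on the right are multiples of x + y: F + xy = -z(x+y) and z(F̄xy+1) = -(x+y). -/
theorem tangency_of_symm_two_eq {F x y z : ℂ} (hx : ‖x‖ = 1) (hy : ‖y‖ = 1) (hz : ‖z‖ = 1)
    (h : x * y + y * z + z * x = -F) :
    (x + y) ^ 2 = (F + x * y) * (conj F * (x * y) + 1) := by
  have hc := conj_symm_two hx hy hz h
  have h1 : F + x * y = -(z * (x + y)) := by linear_combination h
  have h2 : z * (conj F * (x * y) + 1) = -(x + y) := by linear_combination hc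
  rw [h1]
  linear_combination (x + y) * h2

theorem isThreePeriodic_iff {a b c ac bc : ℝ} (ha : 0 < a) (hb : 0 < b) (hac : 0 < ac)
    (hbc : 0 < bc)
    (h : -(c ^ 2 * ac ^ 2) + (a * b + a * bc + ac * b) * (a * b - a * bc - ac * b) = 0)
    (T : Affine.Triangle ℝ Plane) :
    IsThreePeriodic (outerEllipse a b c) (innerEllipse ac bc) T ↔
      ∃ w : Fin 3 → ℂ, (∀ i, ‖w i‖ = 1) ∧ (∀ i, T.points i = shearMap a b c (w i)) ∧
        w 0 * w 1 + w 1 * w 2 + w 2 * w 0 = -ponceletConst a b c ac bc := by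
  have hF := norm_ponceletConst_lt_one ha hb hac hbc h
  constructor
  · rintro ⟨hE, hT⟩
    choose w hw hwT using fun i => (mem_outerEllipse_iff c ha.ne' hb.ne' _).1 (hE i)
    have hne : ∀ i j, i ≠ j → w i ≠ w j := by
      intro i j hij hwij
      apply hij
      apply T.independent.injective
      rw [← hwT, ← hwT, hwij]
    have ht : ∀ i j, i ≠ j → _ := fun i j hij =>
      (lineTangent_shearMap_iff ha.ne' hb.ne' hac.ne' hbc.ne' h (hw i) (hw j) (hne i j hij)).1
        (by rw [hwT, hwT]; exact hT i j hij)
    exact ⟨w, hw, fun i => (hwT i).symm, symm_two_eq_of_tangency hF (hw 0)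
      (hne 1 2 (by decide)) (ht 0 1 (by decide)) (ht 0 2 (by decide))⟩
  · rintro ⟨w, hw, hwT, hs⟩
    refine ⟨fun i => (mem_outerEllipse_iff c ha.ne' hb.ne' _).2 ⟨w i, hw i, (hwT i).symm⟩, ?_⟩
    intro i j hij
    have hne : w i ≠ w j := by
      intro hwij
      apply hij
      apply T.independent.injective
      rw [hwT, hwT, hwij]
    rw [hwT, hwT, lineTangent_shearMap_iff ha.ne' hb.ne' hac.ne' hbc.ne' h (hw i) (hw j) hne]
    have h01 := tangency_of_symm_two_eq (F := ponceletConst a b c ac bc)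
      (hw 0) (hw 1) (hw 2) hs
    have h12 := tangency_of_symm_two_eq (F := ponceletConst a b c ac bc)
      (hw 1) (hw 2) (hw 0) (by linear_combination hs)
    have h20 := tangency_of_symm_two_eq (F := ponceletConst a b c ac bc)
      (hw 2) (hw 0) (hw 1) (by linear_combination hs)
    fin_cases i <;> fin_cases j <;> simp only [ne_eq, not_true_eq_false] at hij <;>
      first
        | exact h01
        | exact h12
        | exact h20
        | (rw [add_comm, mul_comm (w _) (w _)]; first | exact h01 | exact h12 | exact h20)

/-! ### Every unit l is the product of such a triple. -/

/-- The roots of `w (w² - F) = l (1 - conj F w²)`, with `‖F‖ < 1` and `‖l‖ = 1`, lie on the unit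
circle. -/
theorem norm_eq_one_of_blaschke {F l w : ℂ} (hF : ‖F‖ < 1) (hl : ‖l‖ = 1)
    (h : w * (w ^ 2 - F) = l * (1 - conj F * w ^ 2)) : ‖w‖ = 1 := by
  have hn := congrArg Complex.normSq h
  rw [Complex.normSq_mul, Complex.normSq_mul, Complex.normSq_eq_norm_sq l, hl, one_pow,
    one_mul] at hn
  -- This identity gives |w²-F| - |1-F̄w²| the sign of |w| - 1, so the two sides of the equation
  -- cannot have equal modulus off the unit circle.
  have hk : Complex.normSq (w ^ 2 - F) - Complex.normSq (1 - conj F * w ^ 2)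
      = (Complex.normSq w ^ 2 - 1) * (1 - Complex.normSq F) := by
    rw [Complex.normSq_sub, Complex.normSq_sub, Complex.normSq_mul, Complex.normSq_conj,
      map_pow, Complex.normSq_one]
    have : (w ^ 2 * conj F).re = (1 * conj (conj F * w ^ 2)).re := by
      rw [one_mul, Complex.conj_re, mul_comm]
    rw [this]; ring
  have hF' : 0 < 1 - Complex.normSq F := by
    rw [Complex.normSq_eq_norm_sq]; nlinarith [norm_nonneg F]
  have hB := Complex.normSq_nonneg (1 - conj F * w ^ 2)
  have hA := Complex.normSq_nonneg (w ^ 2 - F)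
  have hw0 := Complex.normSq_nonneg w
  set n := Complex.normSq w with hnn
  have hn1 : n = 1 := by
    rcases lt_trichotomy n 1 with h1 | h1 | h1
    · exfalso
      have h2 : (n ^ 2 - 1) * (1 - Complex.normSq F) < 0 := by
        apply mul_neg_of_neg_of_pos _ hF'; nlinarith
      nlinarith
    · exact h1
    · exfalso
      have h2 : 0 < (n ^ 2 - 1) * (1 - Complex.normSq F) := by
        apply mul_pos _ hF'; nlinarith
      nlinarith
  rw [hnn, Complex.normSq_eq_norm_sq] at hn1
  nlinarith [norm_nonneg w]

/-- If x = y, then |F| = |x + 2z| ≥ 2 - 1. -/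
theorem ne_of_symm_two {F x y z : ℂ} (hF : ‖F‖ < 1) (hx : ‖x‖ = 1) (hz : ‖z‖ = 1)
    (h : x * y + y * z + z * x = -F) : x ≠ y := by
  rintro rfl
  have h1 : x * (x + 2 * z) = -F := by linear_combination h
  have h2 := congrArg norm h1
  rw [norm_mul, hx, one_mul, norm_neg] at h2
  have h3 : ‖2 * z‖ ≤ ‖x + 2 * z‖ + ‖x‖ := by
    simpa using norm_sub_le (x + 2 * z) x
  rw [norm_mul, hz, hx] at h3
  norm_num at h3
  linarith

theorem exists_unit_triple {F l : ℂ} (hF : ‖F‖ < 1) (hl : ‖l‖ = 1) :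
    ∃ w : Fin 3 → ℂ, (∀ i, ‖w i‖ = 1) ∧ Function.Injective w ∧
      w 0 * w 1 + w 1 * w 2 + w 2 * w 0 = -F ∧ w 0 * w 1 * w 2 = l := by
  -- The monic cubic with e₁ = -F̄l, e₂ = -F, e₃ = l; its roots solve the Blaschke equation.
  let P : Cubic ℂ := ⟨1, l * conj F, -F, -l⟩
  have ha : P.a ≠ 0 := one_ne_zero
  obtain ⟨x, y, z, hr⟩ := (Cubic.splits_iff_roots_eq_three (φ := RingHom.id ℂ) ha).1
    (IsAlgClosed.splits _)
  have hsum := Cubic.b_eq_three_roots ha hr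
  have hs2 := Cubic.c_eq_three_roots ha hr
  have hs3 := Cubic.d_eq_three_roots ha hr
  simp only [RingHom.id_apply, P, one_mul] at hsum hs2 hs3
  have hroot : ∀ w, (w - x) * (w - y) * (w - z) = 0 → ‖w‖ = 1 := by
    intro w hw
    apply norm_eq_one_of_blaschke hF hl
    linear_combination hw + w ^ 2 * hsum + w * hs2 + hs3
  have hx := hroot x (by ring)
  have hy := hroot y (by ring)
  have hz := hroot z (by ring)
  have h2 : x * y + y * z + z * x = -F := by linear_combination -hs2
  have hxy := ne_of_symm_two hF hx hz h2
  have hyz := ne_of_symm_two hF hy hx (x := y) (y := z) (z := x) (by linear_combination h2)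
  have hzx := ne_of_symm_two hF hz hy (x := z) (y := x) (z := y) (by linear_combination h2)
  refine ⟨![x, y, z], ?_, ?_, ?_, ?_⟩
  · intro i; fin_cases i <;> assumption
  · intro i j hij
    fin_cases i <;> fin_cases j <;> simp_all
  · exact h2
  · change x * y * z = l
    linear_combination hs3

theorem affineIndependent_shearMap {a b : ℝ} (c : ℝ) (ha : a ≠ 0) (hb : b ≠ 0) {w : Fin 3 → ℂ}
    (hw : ∀ i, ‖w i‖ = 1) (hinj : Function.Injective w) :
    AffineIndependent ℝ (fun i => shearMap a b c (w i)) := by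
  have hc : EuclideanGeometry.Cospherical (Set.range w) := by
    refine ⟨0, 1, ?_⟩
    rintro _ ⟨i, rfl⟩
    rw [dist_zero_right, hw]
  exact (hc.affineIndependent subset_rfl hinj).map' (shearMap a b c).toAffineMap
    (shearMap_injective c ha hb)

/-- Common reduction for both loci: a center that depends only on l = e₃ sweeps out the image of the
unit circle. -/
theorem exists_threePeriodic_iff {a b c ac bc : ℝ} (ha : 0 < a) (hb : 0 < b) (hac : 0 < ac)
    (hbc : 0 < bc)
    (h : -(c ^ 2 * ac ^ 2) + (a * b + a * bc + ac * b) * (a * b - a * bc - ac * b) = 0)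
    {α : Type*} (f : Affine.Triangle ℝ Plane → α) (g : ℂ → α)
    (hfg : ∀ (T : Affine.Triangle ℝ Plane) (w : Fin 3 → ℂ), (∀ i, ‖w i‖ = 1) →
      (∀ i, T.points i = shearMap a b c (w i)) →
      w 0 * w 1 + w 1 * w 2 + w 2 * w 0 = -ponceletConst a b c ac bc →
      f T = g (w 0 * w 1 * w 2)) (X : α) :
    (∃ T : Affine.Triangle ℝ Plane,
      IsThreePeriodic (outerEllipse a b c) (innerEllipse ac bc) T ∧ X = f T) ↔
    ∃ l : ℂ, ‖l‖ = 1 ∧ X = g l := by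
  constructor
  · rintro ⟨T, hT, rfl⟩
    obtain ⟨w, hw, hwT, hs⟩ := (isThreePeriodic_iff ha hb hac hbc h T).1 hT
    exact ⟨w 0 * w 1 * w 2, by simp [hw], hfg T w hw hwT hs⟩
  · rintro ⟨l, hl, rfl⟩
    obtain ⟨w, hw, hinj, hs, hp⟩ :=
      exists_unit_triple (norm_ponceletConst_lt_one ha hb hac hbc h) hl
    let T : Affine.Triangle ℝ Plane :=
      ⟨fun i => shearMap a b c (w i), affineIndependent_shearMap c ha.ne' hb.ne' hw hinj⟩
    refine ⟨T, (isThreePeriodic_iff ha hb hac hbc h T).2 ⟨w, hw, fun _ => rfl, hs⟩, ?_⟩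
    rw [hfg T w hw (fun _ => rfl) hs, hp]

/-! ### The two centers as functions of l. -/

/-- The coefficient of `w ^ 2` in the expression of `‖shearMap a b c w‖ ^ 2` on the unit circle. -/
noncomputable def shearQuad (a b c : ℝ) : ℂ := ⟨(a ^ 2 + c ^ 2 - b ^ 2) / 2, -(b * c)⟩

/-- The linear functional `X ↦ 2 ⟪shearMap a b c w, X⟫` of `w`, as a complex number whose product
with `w` has this real part. -/
noncomputable def shearDual (a b c : ℝ) (X : Plane) : ℂ := ⟨2 * (a * X 0 + c * X 1), -(2 * b * X 1)⟩

/-- The value of `shearDual` at the circumcenter of the 3-periodic with parameter `l`. -/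
noncomputable def circumDual (G F l : ℂ) : ℂ := -(G * conj F * l) + conj G * conj l

/-- The inverse of `shearDual`. -/
noncomputable def shearDualInv (a b c : ℝ) (H : ℂ) : Plane :=
  !₂[(H.re + c * H.im / b) / (2 * a), -H.im / (2 * b)]

theorem shearDual_shearDualInv {a b : ℝ} (c : ℝ) (ha : a ≠ 0) (hb : b ≠ 0) (H : ℂ) :
    shearDual a b c (shearDualInv a b c H) = H := by
  apply Complex.ext
  · change 2 * (a * ((H.re + c * H.im / b) / (2 * a)) + c * (-H.im / (2 * b))) = H.re
    field_simp; ring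
  · change -(2 * b * (-H.im / (2 * b))) = H.im
    field_simp

theorem eq_shearDualInv_iff {a b : ℝ} (c : ℝ) (ha : a ≠ 0) (hb : b ≠ 0) (X : Plane) (H : ℂ) :
    X = shearDualInv a b c H ↔ shearDual a b c X = H := by
  constructor
  · rintro rfl
    exact shearDual_shearDualInv c ha hb H
  · rintro rfl
    apply plane_ext
    · change X 0 = (2 * (a * X 0 + c * X 1) + c * (-(2 * b * X 1)) / b) / (2 * a)
      field_simp; ring
    · change X 1 = -(-(2 * b * X 1)) / (2 * b)
      field_simp

/-- A point is the circumcenter when Re(Gw² - Hw) agrees at the three vertices, with G = `shearQuad`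
and H = `shearDual`. -/
theorem dist_sq_shearMap (a b c : ℝ) {w : ℂ} (hw : ‖w‖ = 1) (X : Plane) :
    dist (shearMap a b c w) X ^ 2 = (a ^ 2 + b ^ 2 + c ^ 2) / 2 + X 0 ^ 2 + X 1 ^ 2
      + (shearQuad a b c * w ^ 2 - shearDual a b c X * w).re := by
  rw [EuclideanSpace.dist_eq, Real.sq_sqrt (by positivity), Fin.sum_univ_two, Real.dist_eq,
    Real.dist_eq, sq_abs, sq_abs, shearMap_zero_coord, shearMap_one_coord]
  have h := unit_re_im hw
  simp only [shearQuad, shearDual, Complex.sub_re, Complex.mul_re, pow_two, Complex.mul_im]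
  linear_combination ((a ^ 2 + b ^ 2 + c ^ 2) / 2) * h

/-- By e₁ = -F̄e₃ and e₂ = -F, the expression differs from GF by Gyz minus its conjugate, which is
purely imaginary. -/
theorem circumDual_const {F G x y z : ℂ} (hx : ‖x‖ = 1) (hy : ‖y‖ = 1) (hz : ‖z‖ = 1)
    (h : x * y + y * z + z * x = -F) :
    (G * x ^ 2 - circumDual G F (x * y * z) * x).re = (G * F).re := by
  have hc := conj_symm_two hx hy hz h
  have hx1 := unit_mul_conj hx
  have e : G * x ^ 2 - circumDual G F (x * y * z) * x
      = G * F + (G * (y * z) - conj (G * (y * z))) := by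
    simp only [circumDual, map_mul]
    linear_combination (G * x) * hc - G * h - conj G * conj y * conj z * hx1
  rw [e, Complex.add_re, Complex.sub_re, Complex.conj_re, sub_self, add_zero]

theorem circumcenter_eq_shearDualInv {a b : ℝ} (c : ℝ) (ha : a ≠ 0) (hb : b ≠ 0) {F : ℂ}
    (T : Affine.Triangle ℝ Plane) (w : Fin 3 → ℂ) (hw : ∀ i, ‖w i‖ = 1)
    (hT : ∀ i, T.points i = shearMap a b c (w i))
    (hs : w 0 * w 1 + w 1 * w 2 + w 2 * w 0 = -F) :
    T.circumcenter =
      shearDualInv a b c (circumDual (shearQuad a b c) F (w 0 * w 1 * w 2)) := by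
  symm
  set O := shearDualInv a b c (circumDual (shearQuad a b c) F (w 0 * w 1 * w 2)) with hO
  have hspan : affineSpan ℝ (Set.range T.points) = ⊤ := by
    rw [T.independent.affineSpan_eq_top_iff_card_eq_finrank_add_one]
    simp
  have hd : ∀ i, dist (T.points i) O ^ 2 = (a ^ 2 + b ^ 2 + c ^ 2) / 2 + O 0 ^ 2 + O 1 ^ 2
      + (shearQuad a b c * F).re := by
    intro i
    rw [hT, dist_sq_shearMap a b c (hw i), hO, shearDual_shearDualInv c ha hb, ← hO]
    congr 1
    fin_cases i
    · exact circumDual_const (hw 0) (hw 1) (hw 2) hs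
    · have := circumDual_const (G := shearQuad a b c) (F := F) (hw 1) (hw 2) (hw 0)
        (by linear_combination hs)
      rwa [show w 1 * w 2 * w 0 = w 0 * w 1 * w 2 by ring] at this
    · have := circumDual_const (G := shearQuad a b c) (F := F) (hw 2) (hw 0) (hw 1)
        (by linear_combination hs)
      rwa [show w 2 * w 0 * w 1 = w 0 * w 1 * w 2 by ring] at this
  refine T.eq_circumcenter_of_dist_eq (r := dist (T.points 0) O) (by rw [hspan]; trivial) ?_
  intro i
  exact (sq_eq_sq₀ dist_nonneg dist_nonneg).1 ((hd i).trans (hd 0).symm)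

/-- Euler line: the center is O + (3/2)(centroid - O), O being the circumcenter. -/
theorem ninePointCircle_center_apply (T : Affine.Triangle ℝ Plane) (i : Fin 2) :
    T.ninePointCircle.center i =
      ((T.points 0 i + T.points 1 i + T.points 2 i) - T.circumcenter i) / 2 := by
  have h := T.centroid_vsub_eq T.circumcenter
  have hi := congrArg (fun X : Plane => X i) h
  rw [Affine.Simplex.ninePointCircle_center]
  simp [Fin.sum_univ_three] at hi ⊢
  linear_combination (3 / 2 : ℝ) * hi

/-- The coefficient of `l` in the nine-point center of the 3-periodic with parameter `l`. -/
noncomputable def ninePointU (a b c : ℝ) (F : ℂ) : ℂ :=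
  -((⟨a + b, c⟩ ^ 2) * (conj ⟨a + b, c⟩ * conj F + conj ⟨a - b, c⟩)) / (16 * a * b : ℝ)

/-- The coefficient of `conj l` in the nine-point center of the 3-periodic with parameter `l`. -/
noncomputable def ninePointV (a b c : ℝ) (F : ℂ) : ℂ :=
  ((⟨a - b, c⟩ ^ 2) * (conj ⟨a - b, c⟩ * F + conj ⟨a + b, c⟩)) / (16 * a * b : ℝ)

theorem ninePointCircle_center_eq {a b : ℝ} (c : ℝ) (ha : a ≠ 0) (hb : b ≠ 0) {F : ℂ}
    (T : Affine.Triangle ℝ Plane) (w : Fin 3 → ℂ) (hw : ∀ i, ‖w i‖ = 1)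
    (hT : ∀ i, T.points i = shearMap a b c (w i))
    (hs : w 0 * w 1 + w 1 * w 2 + w 2 * w 0 = -F) :
    T.ninePointCircle.center =
      -- `shearMap 1 1 0` is the standard identification of ℂ with the plane. The vertex sum is the
      -- image of e₁ = -F̄l, hence also real-linear in l.
      shearMap 1 1 0 (ninePointU a b c F * (w 0 * w 1 * w 2)
        + ninePointV a b c F * conj (w 0 * w 1 * w 2)) := by
  have hc := conj_symm_two (hw 0) (hw 1) (hw 2) hs
  have hO := circumcenter_eq_shearDualInv c ha hb T w hw hT hs
  set l := w 0 * w 1 * w 2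
  have hre := congrArg Complex.re hc
  have him := congrArg Complex.im hc
  simp only [Complex.add_re, Complex.add_im, Complex.neg_re, Complex.neg_im, Complex.mul_re,
    Complex.mul_im, Complex.conj_re, Complex.conj_im] at hre him
  have hl0 : T.circumcenter 0 = ((circumDual (shearQuad a b c) F l).re
      + c * (circumDual (shearQuad a b c) F l).im / b) / (2 * a) := by rw [hO]; rfl
  have hl1 : T.circumcenter 1 = -(circumDual (shearQuad a b c) F l).im / (2 * b) := by
    rw [hO]; rfl
  apply plane_ext
  · rw [ninePointCircle_center_apply, hl0, hT, hT, hT]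
    simp only [shearMap_zero_coord, circumDual, shearQuad, ninePointU, ninePointV,
      Complex.add_re, Complex.add_im, Complex.neg_re, Complex.neg_im, Complex.mul_re,
      Complex.mul_im, Complex.conj_re, Complex.conj_im, pow_two, Complex.div_ofReal_re,
      Complex.div_ofReal_im]
    field_simp
    linear_combination (64 * a ^ 2 * b) * hre
  · rw [ninePointCircle_center_apply, hl1, hT, hT, hT]
    simp only [shearMap_one_coord, circumDual, shearQuad, ninePointU, ninePointV,
      Complex.add_re, Complex.add_im, Complex.neg_re, Complex.neg_im, Complex.mul_re,
      Complex.mul_im, Complex.conj_re, Complex.conj_im, pow_two, Complex.div_ofReal_re,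
      Complex.div_ofReal_im]
    field_simp
    linear_combination (64 * a * b) * (c * hre + b * him)

/-! ### Ellipses in the form Ul + Vl̄. -/

theorem exists_unit_polar (z : ℂ) : ∃ e : ℂ, ‖e‖ = 1 ∧ z = ‖z‖ * e :=
  ⟨Complex.exp (z.arg * Complex.I), Complex.norm_exp_ofReal_mul_I _,
    (Complex.norm_mul_exp_arg_mul_I z).symm⟩

theorem exists_unit_mul_of_norm_eq {z : ℂ} {r : ℝ} (h : ‖z‖ = |r|) :
    ∃ e : ℂ, ‖e‖ = 1 ∧ z = r * e := by
  obtain ⟨e, he, hz⟩ := exists_unit_polar z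
  rcases abs_choice r with hr | hr
  · exact ⟨e, he, by rw [hz, h, hr]⟩
  · exact ⟨-e, by rwa [norm_neg], by rw [hz, h, hr]; push_cast; ring⟩

theorem norm_eq_one_iff_exists_cos_sin (m : ℂ) :
    ‖m‖ = 1 ↔ ∃ t : ℝ, m = Real.cos t + Real.sin t * Complex.I := by
  constructor
  · intro h
    refine ⟨m.arg, ?_⟩
    have := Complex.norm_mul_exp_arg_mul_I m
    rw [h, Complex.ofReal_one, one_mul, Complex.exp_mul_I] at this
    push_cast
    exact this.symm
  · rintro ⟨t, rfl⟩
    push_cast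
    rw [← Complex.exp_mul_I]
    exact Complex.norm_exp_ofReal_mul_I t

/-- Write U = rα and V = sβ with r, s real and α, β unit, and choose e² = αβ. The substitution l =
ᾱem gives e(rm + sm̄), an ellipse with axes along e and ie and signed semi-axes r + s = p, r - s =
q. -/
theorem exists_axis_of_norm_eq {U V : ℂ} {p q : ℝ} (hU : ‖U‖ = |(p + q) / 2|)
    (hV : ‖V‖ = |(p - q) / 2|) :
    ∃ e : ℂ, ‖e‖ = 1 ∧ ∀ z : ℂ, (∃ l : ℂ, ‖l‖ = 1 ∧ z = U * l + V * conj l) ↔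
      ∃ t : ℝ, z = (p * Real.cos t : ℝ) * e + (q * Real.sin t : ℝ) * (Complex.I * e) := by
  obtain ⟨α, hα, rfl⟩ := exists_unit_mul_of_norm_eq hU
  obtain ⟨β, hβ, rfl⟩ := exists_unit_mul_of_norm_eq hV
  obtain ⟨e, he⟩ := IsAlgClosed.exists_eq_mul_self (α * β)
  have he1 : ‖e‖ = 1 := by
    have := congrArg norm he
    rw [norm_mul, norm_mul, hα, hβ] at this
    nlinarith [norm_nonneg e]
  have hαα := unit_mul_conj hα
  have hee := unit_mul_conj he1
  have hval : ∀ t : ℝ, ((p + q) / 2 : ℝ) * (e * (Real.cos t + Real.sin t * Complex.I))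
      + ((p - q) / 2 : ℝ) * (e * conj ((Real.cos t : ℂ) + Real.sin t * Complex.I))
      = (p * Real.cos t : ℝ) * e + (q * Real.sin t : ℝ) * (Complex.I * e) := by
    intro t
    simp only [map_add, map_mul, Complex.conj_ofReal, Complex.conj_I]
    push_cast
    ring
  refine ⟨e, he1, fun z => ⟨?_, ?_⟩⟩
  · rintro ⟨l, hl, rfl⟩
    obtain ⟨t, ht⟩ := (norm_eq_one_iff_exists_cos_sin (α * l * conj e)).1 (by
      rw [norm_mul, norm_mul, RCLike.norm_conj, hα, hl, he1]; norm_num)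
    refine ⟨t, ?_⟩
    rw [← hval, ← ht]
    simp only [map_mul, Complex.conj_conj]
    linear_combination (-(((p + q) / 2 : ℝ) : ℂ) * α * l) * hee
      + (((p - q) / 2 : ℝ) : ℂ) * conj l * (conj α * he - β * hαα)
  · rintro ⟨t, rfl⟩
    set m : ℂ := Real.cos t + Real.sin t * Complex.I with hm
    have hm1 : ‖m‖ = 1 := (norm_eq_one_iff_exists_cos_sin m).2 ⟨t, hm⟩
    refine ⟨conj α * e * m, ?_, ?_⟩
    · rw [norm_mul, norm_mul, RCLike.norm_conj, hα, he1, hm1]; norm_num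
    · rw [← hval, ← hm]
      simp only [map_mul, Complex.conj_conj]
      linear_combination (-(((p + q) / 2 : ℝ) : ℂ) * e * m) * hαα
        - (((p - q) / 2 : ℝ) : ℂ) * conj m * (e * hee + conj e * he)

/-- The signs of the semi-axes do not matter in the parametrization of an ellipse. -/
theorem exists_param_abs_iff {E : Type*} [AddCommGroup E] [Module ℝ E] (p q : ℝ) (u v X : E) :
    (∃ t : ℝ, X = (p * Real.cos t) • u + (q * Real.sin t) • v) ↔
      ∃ t : ℝ, X = (|p| * Real.cos t) • u + (|q| * Real.sin t) • v := by
  rcases abs_choice p with hp | hp <;> rcases abs_choice q with hq | hq <;> rw [hp, hq]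
  · constructor <;> rintro ⟨t, rfl⟩ <;> exact ⟨-t, by simp⟩
  · constructor <;> rintro ⟨t, rfl⟩ <;> exact ⟨Real.pi - t, by simp⟩
  · constructor <;> rintro ⟨t, rfl⟩ <;> exact ⟨t + Real.pi, by simp⟩

theorem inner_plane (X Y : Plane) : inner ℝ X Y = X 0 * Y 0 + X 1 * Y 1 := by
  rw [EuclideanSpace.inner_eq_star_dotProduct]
  simp [dotProduct, Fin.sum_univ_two, mul_comm]

theorem norm_sq_plane (X : Plane) : ‖X‖ ^ 2 = X 0 ^ 2 + X 1 ^ 2 := by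
  rw [EuclideanSpace.real_norm_sq_eq, Fin.sum_univ_two]

theorem rot90_zero_coord (u : Plane) : rot90 u 0 = -u 1 := rfl

theorem rot90_one_coord (u : Plane) : rot90 u 1 = u 0 := rfl

theorem isEllipse_of_param {S : Set Plane} {u : Plane} {p q : ℝ} (hu : ‖u‖ = 1) (hp : 0 < p)
    (hq : 0 < q)
    (hS : S = {X : Plane | ∃ t : ℝ, X = (p * Real.cos t) • u + (q * Real.sin t) • rot90 u}) :
    IsEllipse S 0 u p q := by
  refine ⟨hu, hp, hq, ?_⟩
  have hu2 : u 0 ^ 2 + u 1 ^ 2 = 1 := by rw [← norm_sq_plane, hu, one_pow]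
  rw [hS]
  ext X
  simp only [Set.mem_ofPred_eq, sub_zero, inner_plane, rot90_zero_coord, rot90_one_coord]
  constructor
  · rintro ⟨t, rfl⟩
    have h := Real.cos_sq_add_sin_sq t
    simp only [PiLp.add_apply, PiLp.smul_apply, smul_eq_mul, rot90_zero_coord, rot90_one_coord]
    have e1 : u 0 * (p * Real.cos t * u 0 + q * Real.sin t * -u 1)
        + u 1 * (p * Real.cos t * u 1 + q * Real.sin t * u 0) = p * Real.cos t := by
      linear_combination (p * Real.cos t) * hu2
    have e2 : -u 1 * (p * Real.cos t * u 0 + q * Real.sin t * -u 1)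
        + u 0 * (p * Real.cos t * u 1 + q * Real.sin t * u 0) = q * Real.sin t := by
      linear_combination (q * Real.sin t) * hu2
    rw [e1, e2, mul_div_cancel_left₀ _ hp.ne', mul_div_cancel_left₀ _ hq.ne', h]
  · intro h
    set x := (u 0 * X 0 + u 1 * X 1) / p with hx
    set y := (-u 1 * X 0 + u 0 * X 1) / q with hy
    have hm : ‖(⟨x, y⟩ : ℂ)‖ = 1 := by
      have := Complex.normSq_mk x y
      rw [Complex.normSq_eq_norm_sq] at this
      nlinarith [norm_nonneg (⟨x, y⟩ : ℂ)]
    obtain ⟨t, ht⟩ := (norm_eq_one_iff_exists_cos_sin _).1 hm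
    have hc : x = Real.cos t := by simpa [-Complex.ofReal_cos, -Complex.ofReal_sin] using congrArg Complex.re ht
    have hs : y = Real.sin t := by simpa [-Complex.ofReal_cos, -Complex.ofReal_sin] using congrArg Complex.im ht
    have hx' : p * Real.cos t = u 0 * X 0 + u 1 * X 1 := by rw [← hc, hx]; field_simp
    have hy' : q * Real.sin t = -u 1 * X 0 + u 0 * X 1 := by rw [← hs, hy]; field_simp
    refine ⟨t, ?_⟩
    rw [hx', hy']
    apply plane_ext
    · simp only [PiLp.add_apply, PiLp.smul_apply, smul_eq_mul, rot90_zero_coord]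
      linear_combination (-X 0) * hu2
    · simp only [PiLp.add_apply, PiLp.smul_apply, smul_eq_mul, rot90_one_coord]
      linear_combination (-X 1) * hu2

/-! ### The implicit equation of the circumcenter locus. -/

theorem normSq_add_conj_mul_conj (F H : ℂ) :
    Complex.normSq (H + conj F * conj H)
      = (1 + Complex.normSq F) * (H.re ^ 2 + H.im ^ 2)
        + 2 * (F.re * (H.re ^ 2 - H.im ^ 2) - 2 * F.im * H.re * H.im) := by
  simp only [Complex.normSq_apply, Complex.add_re, Complex.add_im, Complex.mul_re, Complex.mul_im,
    Complex.conj_re, Complex.conj_im]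
  ring

/-- In H + F̄H̄ the l-terms cancel, leaving Ḡl̄(1-|F|²). The map H ↦ H + F̄H̄ is invertible because
|F| < 1, so only |l| = 1 remains to be expressed. -/
theorem circumDual_range_iff {G F : ℂ} (hF : ‖F‖ < 1) (H : ℂ) :
    (∃ l : ℂ, ‖l‖ = 1 ∧ H = circumDual G F l) ↔
      Complex.normSq (H + conj F * conj H)
        = Complex.normSq G * (1 - Complex.normSq F) ^ 2 := by
  have hk := one_sub_mul_conj_ne_zero hF
  constructor
  · rintro ⟨l, hl, rfl⟩
    have e : circumDual G F l + conj F * conj (circumDual G F l)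
        = conj G * conj l * ((1 - Complex.normSq F : ℝ) : ℂ) := by
      push_cast
      rw [← Complex.mul_conj]
      simp only [circumDual, map_add, map_mul, map_neg, Complex.conj_conj]
      ring
    rw [e, Complex.normSq_mul, Complex.normSq_mul, Complex.normSq_conj, Complex.normSq_conj,
      Complex.normSq_ofReal, Complex.normSq_eq_norm_sq l, hl]
    ring
  · intro h
    have hH : H * (1 - F * conj F) = (H + conj F * conj H) - conj F * conj (H + conj F * conj H) := by
      simp only [map_add, map_mul, Complex.conj_conj]
      ring
    -- For G = `shearQuad` this is the case of a circular outer ellipse: the locus is a point and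
    -- any l serves.
    by_cases hG : G = 0
    · subst hG
      rw [Complex.normSq_zero, zero_mul, Complex.normSq_eq_zero] at h
      refine ⟨1, norm_one, ?_⟩
      apply mul_right_cancel₀ hk
      rw [hH, h]
      simp [circumDual]
    · have hG' : conj G ≠ 0 := by simpa using hG
      have hk' : 1 - conj F * F ≠ 0 := by rwa [mul_comm]
      set μ := (H + conj F * conj H) / ((1 - F * conj F) * conj G) with hμ
      have hμ' : H + conj F * conj H = μ * ((1 - F * conj F) * conj G) := by
        rw [hμ, div_mul_cancel₀ _ (mul_ne_zero hk hG')]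
      refine ⟨conj μ, ?_, ?_⟩
      · have hn : Complex.normSq (1 - F * conj F) = (1 - Complex.normSq F) ^ 2 := by
          rw [Complex.mul_conj, ← Complex.ofReal_one, ← Complex.ofReal_sub, Complex.normSq_ofReal]
          ring
        have hn0 : Complex.normSq G * (1 - Complex.normSq F) ^ 2 ≠ 0 := by
          rw [← hn]
          exact mul_ne_zero (by simpa using hG) (by simpa using hk)
        rw [hμ', Complex.normSq_mul, Complex.normSq_mul, Complex.normSq_conj, hn,
          mul_comm ((1 - Complex.normSq F) ^ 2)] at h
        have h1 := mul_right_cancel₀ hn0 (h.trans (one_mul _).symm)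
        rw [Complex.normSq_eq_norm_sq] at h1
        rw [RCLike.norm_conj]
        nlinarith [norm_nonneg μ]
      · apply mul_right_cancel₀ hk
        rw [hH, hμ']
        simp only [circumDual, map_mul, map_sub, map_one, Complex.conj_conj]
        ring

/-! ### Elimination of c by the Cayley condition. -/

section Cayley

variable {a b c ac bc : ℝ}

/-- The cross term X₀X₁ cancels: this is why the axes of the circumcenter locus follow those of the
inner ellipse even for tilted pairs, and why the aspect ratio is bc/ac. -/
theorem normSq_shearDual (ha : a ≠ 0) (hb : b ≠ 0)
    (h : -(c ^ 2 * ac ^ 2) + (a * b + a * bc + ac * b) * (a * b - a * bc - ac * b) = 0)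
    (X : Plane) :
    Complex.normSq (shearDual a b c X
        + conj (ponceletConst a b c ac bc) * conj (shearDual a b c X))
      = 16 * (ac ^ 2 * X 0 ^ 2 + bc ^ 2 * X 1 ^ 2) := by
  rw [normSq_add_conj_mul_conj, normSq_ponceletConst ha hb h, ponceletConst_re ha hb h,
    ponceletConst_im c ac bc ha hb]
  simp only [shearDual]
  field_simp
  linear_combination (16 * b * X 1 ^ 2) * h

theorem add_sq_add_sq_eq (hac : ac ≠ 0)
    (h : -(c ^ 2 * ac ^ 2) + (a * b + a * bc + ac * b) * (a * b - a * bc - ac * b) = 0) :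
    (a + b) ^ 2 + c ^ 2
      = a * ((ac ^ 2 - bc ^ 2 + b ^ 2) * a + 2 * ac * b * (ac - bc)) / ac ^ 2 := by
  field_simp
  linear_combination -h

theorem sub_sq_add_sq_eq (hac : ac ≠ 0)
    (h : -(c ^ 2 * ac ^ 2) + (a * b + a * bc + ac * b) * (a * b - a * bc - ac * b) = 0) :
    (a - b) ^ 2 + c ^ 2
      = a * ((ac ^ 2 - bc ^ 2 + b ^ 2) * a - 2 * ac * b * (ac + bc)) / ac ^ 2 := by
  field_simp
  linear_combination -h

theorem normSq_shearQuad (a b c : ℝ) :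
    Complex.normSq (shearQuad a b c)
      = ((a + b) ^ 2 + c ^ 2) * ((a - b) ^ 2 + c ^ 2) / 4 := by
  simp only [shearQuad, Complex.normSq_mk]
  ring

theorem locusX3_eq (ha : 0 < a) (hb : 0 < b) (hac : 0 < ac) (hbc : 0 < bc)
    (h : -(c ^ 2 * ac ^ 2) + (a * b + a * bc + ac * b) * (a * b - a * bc - ac * b) = 0) :
    locusX3 (outerEllipse a b c) (innerEllipse ac bc) =
      {X : Plane | 4 * b ^ 2 * ac ^ 2 * (ac ^ 2 * X 0 ^ 2 + bc ^ 2 * X 1 ^ 2)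
        - bc ^ 2 * (((ac ^ 2 - bc ^ 2 + b ^ 2) * a + 2 * ac * b * (ac - bc))
          * ((ac ^ 2 - bc ^ 2 + b ^ 2) * a - 2 * ac * b * (ac + bc))) = 0} := by
  ext X
  have h1 := exists_threePeriodic_iff ha hb hac hbc h (fun T => T.circumcenter)
    (fun l => shearDualInv a b c (circumDual (shearQuad a b c) (ponceletConst a b c ac bc) l))
    (fun T w hw hT hs => circumcenter_eq_shearDualInv c ha.ne' hb.ne' T w hw hT hs) X
  refine h1.trans ?_
  simp only [eq_shearDualInv_iff c ha.ne' hb.ne']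
  rw [circumDual_range_iff (norm_ponceletConst_lt_one ha hb hac hbc h),
    normSq_shearDual ha.ne' hb.ne' h, normSq_ponceletConst ha.ne' hb.ne' h, normSq_shearQuad,
    add_sq_add_sq_eq hac.ne' h, sub_sq_add_sq_eq hac.ne' h, Set.mem_ofPred_eq]
  set P := (ac ^ 2 - bc ^ 2 + b ^ 2) * a + 2 * ac * b * (ac - bc)
  set Q := (ac ^ 2 - bc ^ 2 + b ^ 2) * a - 2 * ac * b * (ac + bc)
  clear_value P Q
  have ha' := ha.ne'
  have hb' := hb.ne'
  have hac' := hac.ne'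
  field_simp
  constructor <;> intro h
  · apply mul_left_cancel₀ (show 16 * ac ^ 2 ≠ 0 by positivity)
    linear_combination h
  · linear_combination (16 * ac ^ 2) * h

theorem normSq_ninePointU (ha : a ≠ 0) (hb : b ≠ 0) (hac : ac ≠ 0)
    (h : -(c ^ 2 * ac ^ 2) + (a * b + a * bc + ac * b) * (a * b - a * bc - ac * b) = 0) :
    Complex.normSq (ninePointU a b c (ponceletConst a b c ac bc))
      = ((semiAxisA5 a b ac bc - semiAxisB5 a b ac bc) / 2) ^ 2 := by
  have e : Complex.normSq (conj ⟨a + b, c⟩ * conj (ponceletConst a b c ac bc) + conj ⟨a - b, c⟩)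
      = ((a + b) ^ 2 + c ^ 2) * Complex.normSq (ponceletConst a b c ac bc)
        + ((a - b) ^ 2 + c ^ 2) + 2 * ((ponceletConst a b c ac bc).re * (a ^ 2 + c ^ 2 - b ^ 2)
          + 2 * b * c * (ponceletConst a b c ac bc).im) := by
    simp only [Complex.normSq_apply, Complex.add_re, Complex.add_im, Complex.mul_re,
      Complex.mul_im, Complex.conj_re, Complex.conj_im]
    ring
  -- Since Im F is a multiple of c, only c² occurs, and the Cayley condition removes it.
  have hc2 : c ^ 2 = (a * b + a * bc + ac * b) * (a * b - a * bc - ac * b) / ac ^ 2 := by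
    field_simp
    linear_combination -h
  have e2 : 2 * b * c * -(2 * ac ^ 2 * c / (a ^ 2 * b)) = -(4 * ac ^ 2 * c ^ 2 / a ^ 2) := by
    field_simp; ring
  rw [ninePointU, Complex.normSq_div, Complex.normSq_neg, Complex.normSq_mul, map_pow,
    Complex.normSq_mk, ← pow_two, ← pow_two, e, Complex.normSq_ofReal,
    normSq_ponceletConst ha hb h, ponceletConst_re ha hb h, ponceletConst_im c ac bc ha hb, e2,
    hc2, semiAxisA5, semiAxisB5]
  field_simp
  ring

theorem normSq_ninePointV (ha : a ≠ 0) (hb : b ≠ 0) (hac : ac ≠ 0)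
    (h : -(c ^ 2 * ac ^ 2) + (a * b + a * bc + ac * b) * (a * b - a * bc - ac * b) = 0) :
    Complex.normSq (ninePointV a b c (ponceletConst a b c ac bc))
      = ((semiAxisA5 a b ac bc + semiAxisB5 a b ac bc) / 2) ^ 2 := by
  have e : Complex.normSq (conj ⟨a - b, c⟩ * ponceletConst a b c ac bc + conj ⟨a + b, c⟩)
      = ((a - b) ^ 2 + c ^ 2) * Complex.normSq (ponceletConst a b c ac bc)
        + ((a + b) ^ 2 + c ^ 2) + 2 * ((ponceletConst a b c ac bc).re * (a ^ 2 + c ^ 2 - b ^ 2)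
          + 2 * b * c * (ponceletConst a b c ac bc).im) := by
    simp only [Complex.normSq_apply, Complex.add_re, Complex.add_im, Complex.mul_re,
      Complex.mul_im, Complex.conj_re, Complex.conj_im]
    ring
  have hc2 : c ^ 2 = (a * b + a * bc + ac * b) * (a * b - a * bc - ac * b) / ac ^ 2 := by
    field_simp
    linear_combination -h
  have e2 : 2 * b * c * -(2 * ac ^ 2 * c / (a ^ 2 * b)) = -(4 * ac ^ 2 * c ^ 2 / a ^ 2) := by
    field_simp; ring
  rw [ninePointV, Complex.normSq_div, Complex.normSq_mul, map_pow,
    Complex.normSq_mk, ← pow_two, ← pow_two, e, Complex.normSq_ofReal,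
    normSq_ponceletConst ha hb h, ponceletConst_re ha hb h, ponceletConst_im c ac bc ha hb, e2,
    hc2, semiAxisA5, semiAxisB5]
  field_simp
  ring

theorem exists_axis_locusX5 (ha : 0 < a) (hb : 0 < b) (hac : 0 < ac) (hbc : 0 < bc)
    (h : -(c ^ 2 * ac ^ 2) + (a * b + a * bc + ac * b) * (a * b - a * bc - ac * b) = 0) :
    ∃ u : Plane, ‖u‖ = 1 ∧
      locusX5 (outerEllipse a b c) (innerEllipse ac bc) =
        {X : Plane | ∃ t : ℝ, X = (|semiAxisA5 a b ac bc| * Real.cos t) • u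
          + (|semiAxisB5 a b ac bc| * Real.sin t) • rot90 u} := by
  set p := semiAxisA5 a b ac bc with hp
  set q := semiAxisB5 a b ac bc with hq
  have hU := normSq_ninePointU ha.ne' hb.ne' hac.ne' h
  have hV := normSq_ninePointV ha.ne' hb.ne' hac.ne' h
  rw [← hp, ← hq] at hU hV
  rw [Complex.normSq_eq_norm_sq, ← abs_of_nonneg (norm_nonneg _), sq_eq_sq_iff_abs_eq_abs,
    abs_abs, abs_of_nonneg (norm_nonneg _)] at hU hV
  -- The sign of q is flipped because |U| is the half difference and |V| the half sum of the signed
  -- semi-axes.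
  obtain ⟨e, he, hax⟩ := exists_axis_of_norm_eq (p := p) (q := -q) (by rwa [← sub_eq_add_neg])
    (by rwa [sub_neg_eq_add])
  have h1 := exists_threePeriodic_iff ha hb hac hbc h (fun T => T.ninePointCircle.center)
    (fun l => shearMap 1 1 0 (ninePointU a b c (ponceletConst a b c ac bc) * l
      + ninePointV a b c (ponceletConst a b c ac bc) * conj l))
    (fun T w hw hT hs => ninePointCircle_center_eq c ha.ne' hb.ne' T w hw hT hs)
  refine ⟨shearMap 1 1 0 e, ?_, ?_⟩
  · have h2 := norm_sq_plane (shearMap 1 1 0 e)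
    simp only [shearMap_zero_coord, shearMap_one_coord] at h2
    have := unit_re_im he
    nlinarith [norm_nonneg (shearMap 1 1 0 e)]
  · ext X
    rw [← abs_neg q]
    refine (h1 X).trans (Iff.trans ?_ (exists_param_abs_iff p (-q) _ _ X))
    have hrot : rot90 (shearMap 1 1 0 e) = shearMap 1 1 0 (Complex.I * e) := by
      apply plane_ext <;> simp [rot90_zero_coord, rot90_one_coord]
    have hsmul : ∀ t : ℝ, shearMap 1 1 0 ((p * Real.cos t : ℝ) * e
        + (-q * Real.sin t : ℝ) * (Complex.I * e))
        = (p * Real.cos t) • shearMap 1 1 0 e + (-q * Real.sin t) • rot90 (shearMap 1 1 0 e) := by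
      intro t
      rw [hrot, map_add, ← Complex.real_smul, ← Complex.real_smul, map_smul, map_smul]
    constructor
    · rintro ⟨l, hl, rfl⟩
      obtain ⟨t, ht⟩ := (hax _).1 ⟨l, hl, rfl⟩
      exact ⟨t, by rw [ht, hsmul]⟩
    · rintro ⟨t, rfl⟩
      obtain ⟨l, hl, hlt⟩ := (hax _).2 ⟨t, rfl⟩
      exact ⟨l, hl, by rw [← hlt, hsmul]⟩

end Cayley

theorem mainTheorem7 (a b c ac bc : ℝ) (ha : 0 < a) (hb : 0 < b) (hac : 0 < ac) (hbc : 0 < bc)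
    (hCayley : -(c ^ 2 * ac ^ 2)
      + (a * b + a * bc + ac * b) * (a * b - a * bc - ac * b) = 0) :
    -- the locus of the circumcenter is an ellipse centered at the origin,
    -- with axes along the coordinate axes and aspect ratio `bc / ac`
    (¬ (a = b ∧ c = 0) →
      ∃ p q : ℝ, IsEllipse (locusX3 (outerEllipse a b c) (innerEllipse ac bc)) 0 !₂[1, 0] p q ∧
        p / q = bc / ac) ∧
    -- its equation
    locusX3 (outerEllipse a b c) (innerEllipse ac bc) =
      {X : Plane | 4 * b ^ 2 * ac ^ 2 * (ac ^ 2 * X 0 ^ 2 + bc ^ 2 * X 1 ^ 2)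
        - bc ^ 2 * (((ac ^ 2 - bc ^ 2 + b ^ 2) * a + 2 * ac * b * (ac - bc))
          * ((ac ^ 2 - bc ^ 2 + b ^ 2) * a - 2 * ac * b * (ac + bc))) = 0} ∧
    -- the locus of the nine-point center is an ellipse centered at the origin, with the given
    -- semi-axes; it collapses to a segment or a point exactly when one of these vanishes
    ∃ u : Plane, ‖u‖ = 1 ∧
      locusX5 (outerEllipse a b c) (innerEllipse ac bc) =
        {X : Plane | ∃ t : ℝ, X = (|semiAxisA5 a b ac bc| * Real.cos t) • u
          + (|semiAxisB5 a b ac bc| * Real.sin t) • rot90 u} ∧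
      (semiAxisA5 a b ac bc ≠ 0 → semiAxisB5 a b ac bc ≠ 0 →
        IsEllipse (locusX5 (outerEllipse a b c) (innerEllipse ac bc)) 0 u
          |semiAxisA5 a b ac bc| |semiAxisB5 a b ac bc|) := by
  have h3 := locusX3_eq ha hb hac hbc hCayley
  refine ⟨?_, h3, ?_⟩
  · intro hne
    have hg := add_sq_add_sq_eq hac.ne' hCayley
    have hd := sub_sq_add_sq_eq hac.ne' hCayley
    rw [h3]
    set P := (ac ^ 2 - bc ^ 2 + b ^ 2) * a + 2 * ac * b * (ac - bc)
    set Q := (ac ^ 2 - bc ^ 2 + b ^ 2) * a - 2 * ac * b * (ac + bc)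
    -- P and Q are positive multiples of (a+b)² + c² and (a-b)² + c²; the latter vanishes only for a
    -- circle.
    have hP : 0 < P := by
      have h1 : 0 < a * P / ac ^ 2 := by rw [← hg]; positivity
      have h2 := (div_pos_iff_of_pos_right (by positivity)).1 h1
      exact (pos_iff_pos_of_mul_pos h2).1 ha
    have hQ : 0 < Q := by
      have h1 : 0 < a * Q / ac ^ 2 := by
        rw [← hd]
        by_contra hcon
        have hs1 := sq_nonneg (a - b)
        have hs2 := sq_nonneg c
        have e1 : (a - b) ^ 2 = 0 := by linarith
        have e2 : c ^ 2 = 0 := by linarith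
        exact hne ⟨sub_eq_zero.1 (pow_eq_zero_iff two_ne_zero |>.1 e1),
          pow_eq_zero_iff two_ne_zero |>.1 e2⟩
      have h2 := (div_pos_iff_of_pos_right (by positivity)).1 h1
      exact (pos_iff_pos_of_mul_pos h2).1 ha
    clear_value P Q
    have hPQ := mul_pos hP hQ
    obtain ⟨r, hr, hr2⟩ : ∃ r : ℝ, 0 < r ∧ r ^ 2 = P * Q :=
      ⟨√(P * Q), Real.sqrt_pos.2 hPQ, Real.sq_sqrt hPQ.le⟩
    -- Read off from the equation 4b²ac²(ac²X₀² + bc²X₁²) = bc²r².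
    refine ⟨bc * r / (2 * b * ac ^ 2), r / (2 * b * ac),
      ⟨?_, by positivity, by positivity, ?_⟩, by field_simp⟩
    · rw [← sq_eq_sq₀ (norm_nonneg _) zero_le_one, norm_sq_plane]
      simp
    · ext X
      have e0 : inner ℝ !₂[(1 : ℝ), 0] (X - 0) = X 0 := by
        rw [inner_plane]; simp
      have e1 : inner ℝ (rot90 !₂[(1 : ℝ), 0]) (X - 0) = X 1 := by
        rw [inner_plane, rot90_zero_coord, rot90_one_coord]; simp
      rw [Set.mem_ofPred_eq, Set.mem_ofPred_eq, e0, e1, ← hr2]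
      field_simp
      constructor <;> intro h <;> linear_combination h
  · obtain ⟨u, hu, h5⟩ := exists_axis_locusX5 ha hb hac hbc hCayley
    exact ⟨u, hu, h5, fun hA hB =>
      isEllipse_of_param hu (abs_pos.2 hA) (abs_pos.2 hB) h5⟩
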